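/- Let $R$ be an associative ring with unit; modules are right $R$-modules unless stated otherwise. A module $M$ is called \emph{f-projective} if for every finitely generated submodule $C$ of $M$ the inclusion $C \hookrightarrow M$ factors through a finitely generated free module. For a module $M$, let $\operatorname{add}(M)$ denote the class of all modules isomorphic to direct summands of finite direct sums of copies of $M$. Let $M$ be an f-projective module and let $S = \operatorname{End}_R(M)$, acting on $M$ from the left. Assume that the ring $S$ is right noetherian and that $M$ is flat as a left $S$-module. Let $(G_i, f_{ji} \mid i \le j \in I)$ be a direct system, indexed by a (non-empty) directed set $I$, of modules $G_i \in \operatorname{add}(M)$. Then every module $N \cong \varinjlim_{i \in I} G_i$ is f-projective. -/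

import Mathlib

open scoped TensorProduct

/-! Right modules over a ring `R` are modules over `Rᵐᵒᵖ`. -/

section Tensor

variable (S : Type*) [Ring S]

/-- The subgroup of `A ⊗[ℤ] M` generated by all `(a · s) ⊗ m - a ⊗ (s · m)`, for a right
`S`-module `A` and a left `S`-module `M`. -/
def balancedRelations (A M : Type*) [AddCommGroup A] [Module Sᵐᵒᵖ A] [AddCommGroup M]
    [Module S M] : AddSubgroup (A ⊗[ℤ] M) :=
  AddSubgroup.closure {t | ∃ (a : A) (s : S) (m : M),
    t = (MulOpposite.op s • a) ⊗ₜ[ℤ] m - a ⊗ₜ[ℤ] (s • m)}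

/-- The tensor product `A ⊗_S M` (an abelian group) of a right module `A` and a left module `M`
over a ring `S` that need not be commutative. -/
abbrev BalancedTensor (A M : Type*) [AddCommGroup A] [Module Sᵐᵒᵖ A] [AddCommGroup M]
    [Module S M] : Type _ :=
  (A ⊗[ℤ] M) ⧸ balancedRelations S A M

/-- The group homomorphism `f ⊗_S M : A ⊗_S M → B ⊗_S M` induced by a homomorphism
`f : A → B` of right `S`-modules. -/
def BalancedTensor.map {A B : Type*} (M : Type*) [AddCommGroup A] [Module Sᵐᵒᵖ A]
    [AddCommGroup B] [Module Sᵐᵒᵖ B] [AddCommGroup M] [Module S M] (f : A →ₗ[Sᵐᵒᵖ] B) :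
    BalancedTensor S A M →+ BalancedTensor S B M :=
  QuotientAddGroup.map _ _
    (LinearMap.rTensor M f.toAddMonoidHom.toIntLinearMap).toAddMonoidHom <| by
    refine (AddSubgroup.closure_le _).2 ?_
    rintro _ ⟨a, s, m, rfl⟩
    exact AddSubgroup.subset_closure ⟨f a, s, m, by simp⟩

end Tensor

universe u v

/-- A left `S`-module `M` is flat if `- ⊗_S M` preserves injectivity of homomorphisms of right
`S`-modules. (Testing on modules in the universe of `S` is no restriction, since it includes the
inclusions of right ideals into `S`.) -/
def IsFlatLeftModule (S : Type u) [Ring S] (M : Type v) [AddCommGroup M] [Module S M] : Prop :=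
  ∀ (A B : Type u) [AddCommGroup A] [Module Sᵐᵒᵖ A] [AddCommGroup B] [Module Sᵐᵒᵖ B]
    (f : A →ₗ[Sᵐᵒᵖ] B), Function.Injective f → Function.Injective (BalancedTensor.map S M f)

/-- A right `R`-module `M` is f-projective if for every finitely generated submodule `C` of `M`,
the inclusion `C → M` factors through a finitely generated free right module `R ^ n`. -/
def IsFProjective (R : Type*) [Ring R] (M : Type*) [AddCommGroup M] [Module Rᵐᵒᵖ M] : Prop :=
  ∀ C : Submodule Rᵐᵒᵖ M, C.FG →
    ∃ (n : ℕ) (g : C →ₗ[Rᵐᵒᵖ] (Fin n → R)) (h : (Fin n → R) →ₗ[Rᵐᵒᵖ] M), h ∘ₗ g = C.subtype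

/-- The right `R`-module `N` belongs to `add M`: it is isomorphic to a direct summand of a finite
direct sum of copies of `M`. -/
def MemAdd (R : Type*) [Ring R] (M N : Type*) [AddCommGroup M] [Module Rᵐᵒᵖ M]
    [AddCommGroup N] [Module Rᵐᵒᵖ N] : Prop :=
  ∃ (n : ℕ) (P Q : Submodule Rᵐᵒᵖ (Fin n → M)), IsCompl P Q ∧ Nonempty (N ≃ₗ[Rᵐᵒᵖ] P)

/-! A finitely generated `C ⊆ N` is the image of a finitely generated `D ⊆ G i`. It suffices to find
`j ≥ i` such that the image of `D` in `G j` maps isomorphically onto `C`, because `G j`, a retract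
of some `M ^ n`, is f-projective. Such a `j` exists because the kernels of `G i → G k` stabilize.
With `G i` a retract of `M ^ a`, flatness shows that the kernel of `M ^ a → G k` is generated by the
values of the maps `M → M ^ a` that it kills. These maps form a right submodule of `S ^ a`, which
grows with `k`, so noetherianity provides a maximal one. -/

/-- For a flat left `S`-module `M` and a homomorphism `φ : S ^ a → S ^ b` of free right modules,
every solution in `M ^ a` of the linear system given by `φ` is a sum of vectors `s • m` with
`s ∈ ker φ` and `m ∈ M`. -/
theorem IsFlatLeftModule.mem_closure_of_sum_smul_eq_zero {S : Type*} [Ring S] {M : Type*}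
    [AddCommGroup M] [Module S M] (hflat : IsFlatLeftModule S M) {a b : ℕ}
    (φ : (Fin a → S) →ₗ[Sᵐᵒᵖ] (Fin b → S)) (x : Fin a → M)
    (hx : ∀ l, ∑ i, φ (Pi.single i 1) l • x i = 0) :
    x ∈ AddSubgroup.closure {y : Fin a → M | ∃ s m, φ s = 0 ∧ y = fun i => s i • m} := by
  set T := AddSubgroup.closure {y : Fin a → M | ∃ s m, φ s = 0 ∧ y = fun i => s i • m} with hT
  let K := LinearMap.ker φ
  -- Flatness is applied to the embedding of `S ^ a / ker φ` into `S ^ b`.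
  let ψ : ((Fin a → S) ⧸ K) →ₗ[Sᵐᵒᵖ] (Fin b → S) := K.liftQ φ le_rfl
  have hψ : Function.Injective ψ :=
    LinearMap.ker_eq_bot.1 (Submodule.ker_liftQ_eq_bot _ _ _ le_rfl)
  let z : ((Fin a → S) ⧸ K) ⊗[ℤ] M := ∑ i, K.mkQ (Pi.single i 1) ⊗ₜ[ℤ] x i
  have hbal : ∀ (c : Fin b → S) (m : M),
      QuotientAddGroup.mk' (balancedRelations S (Fin b → S) M) (c ⊗ₜ[ℤ] m) =
      QuotientAddGroup.mk' (balancedRelations S (Fin b → S) M)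
        (∑ l, (Pi.single l (1 : S) : Fin b → S) ⊗ₜ[ℤ] (c l • m)) := by
    intro c m
    have hc : c = ∑ l, MulOpposite.op (c l) • (Pi.single l (1 : S) : Fin b → S) := by
      ext k
      simp [Finset.sum_apply, Pi.single_apply]
    conv_lhs => rw [hc, TensorProduct.sum_tmul]
    rw [map_sum, map_sum]
    refine Finset.sum_congr rfl fun l _ => ?_
    rw [← sub_eq_zero, ← map_sub]
    exact (QuotientAddGroup.eq_zero_iff _).2 (AddSubgroup.subset_closure ⟨_, _, _, rfl⟩)
  have hz : QuotientAddGroup.mk' (balancedRelations S ((Fin a → S) ⧸ K) M) z = 0 := by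
    apply hflat _ _ ψ hψ
    rw [map_zero]
    have h1 : BalancedTensor.map S M ψ (QuotientAddGroup.mk' _ z) =
        QuotientAddGroup.mk' (balancedRelations S (Fin b → S) M)
          (∑ i, φ (Pi.single i 1) ⊗ₜ[ℤ] x i) := by
      change QuotientAddGroup.mk' (balancedRelations S (Fin b → S) M)
        (LinearMap.rTensor M ψ.toAddMonoidHom.toIntLinearMap z) = _
      congr 1
      simp only [z, map_sum, LinearMap.rTensor_tmul]
      rfl
    rw [h1, map_sum, Finset.sum_congr rfl fun i _ => hbal (φ (Pi.single i 1)) (x i), ← map_sum,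
      Finset.sum_comm]
    simp_rw [← TensorProduct.tmul_sum, hx]
    simp
  -- The action `s ⊗ m ↦ s • m` descends to `(S ^ a / K) ⊗_S M → M ^ a / T`, as `T` contains all `s
  -- • m` with `s ∈ K`. It sends the vanishing class of `z` to that of `x`.
  let scale : (Fin a → S) →+ M →+ (Fin a → M) ⧸ T :=
    AddMonoidHom.mk' (fun s => (QuotientAddGroup.mk' T).comp
      (AddMonoidHom.mk' (fun m i => s i • m) fun m m' => by ext i; simp)) fun s s' => by
        ext m
        simp only [AddMonoidHom.comp_apply, AddMonoidHom.add_apply, ← map_add]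
        congr 1
        ext i
        simp [add_smul]
  let scaleK : ((Fin a → S) ⧸ K) →+ M →+ (Fin a → M) ⧸ T :=
    QuotientAddGroup.lift K.toAddSubgroup scale fun s hs => by
      ext m
      exact (QuotientAddGroup.eq_zero_iff _).2 (AddSubgroup.subset_closure ⟨s, m, hs, rfl⟩)
  have hscale : ∀ s m, scaleK (K.mkQ s) m = QuotientAddGroup.mk' T (fun i => s i • m) :=
    fun _ _ => rfl
  let act : ((Fin a → S) ⧸ K) ⊗[ℤ] M →+ (Fin a → M) ⧸ T :=
    TensorProduct.liftAddHom scaleK fun r c m => by simp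
  have hact : ∀ t ∈ balancedRelations S ((Fin a → S) ⧸ K) M, act t = 0 := by
    change balancedRelations S ((Fin a → S) ⧸ K) M ≤ act.ker
    refine (AddSubgroup.closure_le _).2 ?_
    rintro _ ⟨c, s, m, rfl⟩
    obtain ⟨c, rfl⟩ := K.mkQ_surjective c
    change act _ = 0
    rw [map_sub, sub_eq_zero, ← map_smul]
    change scaleK (K.mkQ _) m = scaleK (K.mkQ _) (s • m)
    rw [hscale, hscale]
    congr 1
    ext i
    simp [mul_smul]
  have h2 := hact z ((QuotientAddGroup.eq_zero_iff z).1 hz)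
  have h3 : act z = QuotientAddGroup.mk' T x := by
    simp only [z, map_sum]
    change ∑ i, scaleK (K.mkQ (Pi.single i 1)) (x i) = _
    simp_rw [hscale]
    rw [← map_sum]
    congr 1
    ext k
    simp [Finset.sum_apply, Pi.single_apply]
  exact (QuotientAddGroup.eq_zero_iff x).1 (h3.symm.trans h2)

/-- If `M` is flat over its endomorphism ring, the kernel of a homomorphism `M ^ a → M ^ b` is
generated by the images of the homomorphisms `M → M ^ a` that it annihilates. -/
theorem IsFlatLeftModule.mem_closure_of_map_eq_zero {A M : Type*} [Ring A] [AddCommGroup M]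
    [Module A M] (hflat : IsFlatLeftModule (Module.End A M) M) {a b : ℕ}
    (φ : (Fin a → M) →ₗ[A] (Fin b → M)) (x : Fin a → M) (hx : φ x = 0) :
    x ∈ AddSubgroup.closure {y : Fin a → M | ∃ (s : Fin a → Module.End A M) (m : M),
      φ ∘ₗ LinearMap.pi s = 0 ∧ y = fun i => s i m} := by
  let Φ : (Fin a → Module.End A M) →ₗ[(Module.End A M)ᵐᵒᵖ] (Fin b → Module.End A M) :=
    { toFun := fun s l => LinearMap.proj l ∘ₗ φ ∘ₗ LinearMap.pi s
      map_add' := fun s t => by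
        ext l m
        simp only [LinearMap.comp_apply, Pi.add_apply, LinearMap.add_apply, LinearMap.proj_apply]
        rw [← Pi.add_apply (φ _) (φ _) l, ← map_add]
        rfl
      map_smul' := fun r s => rfl }
  have hΦ : ∀ s l m, Φ s l m = φ (fun i => s i m) l := fun _ _ _ => rfl
  have key := hflat.mem_closure_of_sum_smul_eq_zero Φ x fun l => by
    simp only [Module.End.smul_def, hΦ]
    have : ∀ i, (fun k => (Pi.single i (1 : Module.End A M) : Fin a → Module.End A M) k (x i)) =
        Pi.single i (x i) := by
      intro i
      ext k
      by_cases h : k = i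
      · subst h; simp
      · simp [h]
    simp_rw [this]
    rw [← Finset.sum_apply, ← map_sum, Finset.univ_sum_single, hx]
    rfl
  refine AddSubgroup.closure_mono ?_ key
  rintro _ ⟨s, m, hs, rfl⟩
  refine ⟨s, m, ?_, rfl⟩
  ext m l
  exact LinearMap.congr_fun (congrFun hs l) m

/-- A member of `add M` is a retract of some `M ^ n`. -/
theorem MemAdd.exists_retract {R M N : Type*} [Ring R] [AddCommGroup M] [Module Rᵐᵒᵖ M]
    [AddCommGroup N] [Module Rᵐᵒᵖ N] (h : MemAdd R M N) :
    ∃ (n : ℕ) (i : N →ₗ[Rᵐᵒᵖ] (Fin n → M)) (p : (Fin n → M) →ₗ[Rᵐᵒᵖ] N),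
      p ∘ₗ i = LinearMap.id := by
  obtain ⟨n, P, Q, hPQ, ⟨e⟩⟩ := h
  refine ⟨n, P.subtype ∘ₗ e.toLinearMap, e.symm.toLinearMap ∘ₗ P.projectionOnto Q hPQ, ?_⟩
  ext x
  simp

/-- Members of `add M` are f-projective if `M` is. -/
theorem IsFProjective.of_memAdd {R M N : Type*} [Ring R] [AddCommGroup M] [Module Rᵐᵒᵖ M]
    [AddCommGroup N] [Module Rᵐᵒᵖ N] (hM : IsFProjective R M) (h : MemAdd R M N) :
    IsFProjective R N := by
  obtain ⟨n, i, p, hpi⟩ := h.exists_retract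
  intro C hC
  -- Each coordinate image of `C` in `M` factors through a free module; the direct sum of these
  -- factors `i` on `C`, and `p` returns to `N`.
  let q : Fin n → N →ₗ[Rᵐᵒᵖ] M := fun k => LinearMap.proj k ∘ₗ i
  choose d g h hgh using fun k => hM (C.map (q k)) (hC.map (q k))
  let gC : C →ₗ[Rᵐᵒᵖ] ((Σ k, Fin (d k)) → R) := LinearMap.pi fun t =>
    LinearMap.proj t.2 ∘ₗ g t.1 ∘ₗ
      ((q t.1).restrict (p := C) (q := C.map (q t.1)) fun _ hx => Submodule.mem_map_of_mem hx)
  let hC : ((Σ k, Fin (d k)) → R) →ₗ[Rᵐᵒᵖ] N := p ∘ₗ LinearMap.pi fun k =>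
    h k ∘ₗ LinearMap.funLeft Rᵐᵒᵖ R fun t : Fin (d k) => (⟨k, t⟩ : Σ k, Fin (d k))
  have hfac : hC ∘ₗ gC = C.subtype := by
    ext c
    have : (LinearMap.pi fun k => h k ∘ₗ
        LinearMap.funLeft Rᵐᵒᵖ R fun t : Fin (d k) => (⟨k, t⟩ : Σ k, Fin (d k))) (gC c) =
        i (c : N) := by
      ext k
      exact LinearMap.congr_fun (hgh k) ⟨q k c, Submodule.mem_map_of_mem c.2⟩
    change p _ = _
    rw [this]
    exact LinearMap.congr_fun hpi c
  let σ := LinearEquiv.funCongrLeft Rᵐᵒᵖ R (Fintype.equivFin (Σ k, Fin (d k)))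
  refine ⟨_, σ.symm.toLinearMap ∘ₗ gC, hC ∘ₗ σ.toLinearMap, ?_⟩
  rw [← hfac]
  ext c
  simp

/-- In a direct system in `add M`, where `M` is flat over its right noetherian endomorphism ring,
the kernels of the transition maps out of each term stabilize. -/
theorem exists_ker_le_ker_of_memAdd {R M : Type*} [Ring R] [AddCommGroup M] [Module Rᵐᵒᵖ M]
    (hS : IsNoetherian (Module.End Rᵐᵒᵖ M)ᵐᵒᵖ (Module.End Rᵐᵒᵖ M))
    (hflat : IsFlatLeftModule (Module.End Rᵐᵒᵖ M) M)
    {I : Type*} [Preorder I] [IsDirectedOrder I]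
    (G : I → Type*) [∀ i, AddCommGroup (G i)] [∀ i, Module Rᵐᵒᵖ (G i)]
    (f : ∀ i j, i ≤ j → G i →ₗ[Rᵐᵒᵖ] G j) [DirectedSystem G fun i j h => f i j h]
    (hG : ∀ i, MemAdd R M (G i)) (i : I) :
    ∃ (j : I) (hij : i ≤ j), ∀ (k : I) (hik : i ≤ k), j ≤ k →
      LinearMap.ker (f i k hik) ≤ LinearMap.ker (f i j hij) := by
  obtain ⟨a, ι, π, hπ⟩ := (hG i).exists_retract
  let K : {k // i ≤ k} → Submodule (Module.End Rᵐᵒᵖ M)ᵐᵒᵖ (Fin a → Module.End Rᵐᵒᵖ M) := fun k =>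
    { carrier := {s | (f i k k.2 ∘ₗ π) ∘ₗ LinearMap.pi s = 0}
      add_mem' := fun {s t} hs ht => by
        ext m
        have hs' := LinearMap.congr_fun hs m
        have ht' := LinearMap.congr_fun ht m
        change (f i k k.2 ∘ₗ π) (LinearMap.pi s m + LinearMap.pi t m) = 0
        rw [map_add]
        exact (congrArg₂ (· + ·) hs' ht').trans (add_zero _)
      zero_mem' := by
        ext m
        exact map_zero (f i k k.2 ∘ₗ π)
      smul_mem' := fun r s hs => by
        ext m
        exact LinearMap.congr_fun hs (r.unop m) }
  obtain ⟨_, ⟨⟨j, hij⟩, rfl⟩, hmax⟩ := set_has_maximal_iff_noetherian.2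
    (inferInstance : IsNoetherian (Module.End Rᵐᵒᵖ M)ᵐᵒᵖ (Fin a → Module.End Rᵐᵒᵖ M))
    (Set.range K) ⟨_, ⟨i, le_rfl⟩, rfl⟩
  refine ⟨j, hij, fun k hik hjk x hx => ?_⟩
  have hK : K ⟨k, hik⟩ ≤ K ⟨j, hij⟩ := by
    have hle : K ⟨j, hij⟩ ≤ K ⟨k, hik⟩ := fun s hs => by
      ext m
      have := congrArg (f j k hjk) (LinearMap.congr_fun hs m)
      simp only [LinearMap.comp_apply, DirectedSystem.map_map' (f := f)] at this
      simpa using this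
    by_contra hn
    exact hmax _ ⟨_, rfl⟩ (lt_of_le_not_ge hle hn)
  -- Composing with the split injection `ι'` gives a map into `M ^ b` with the same kernel.
  obtain ⟨b, ι', π', hπ'⟩ := (hG k).exists_retract
  have hπx : π (ι x) = x := LinearMap.congr_fun hπ x
  have hmem := hflat.mem_closure_of_map_eq_zero (ι' ∘ₗ f i k hik ∘ₗ π) (ι x) (by
    simp only [LinearMap.comp_apply, hπx]
    rw [LinearMap.mem_ker.1 hx, map_zero])
  have hle : AddSubgroup.closure {y : Fin a → M | ∃ (s : Fin a → Module.End Rᵐᵒᵖ M) (m : M),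
      (ι' ∘ₗ f i k hik ∘ₗ π) ∘ₗ LinearMap.pi s = 0 ∧ y = fun i => s i m} ≤
      (LinearMap.ker (f i j hij ∘ₗ π)).toAddSubgroup := by
    refine (AddSubgroup.closure_le _).2 ?_
    rintro _ ⟨s, m, hs, rfl⟩
    have hsk : s ∈ K ⟨k, hik⟩ := by
      ext m
      have h1 := congrArg π' (LinearMap.congr_fun hs m)
      rw [LinearMap.zero_apply, map_zero] at h1
      exact (LinearMap.congr_fun hπ' _).symm.trans h1
    exact LinearMap.congr_fun (hK hsk) m
  have := hle hmem
  change f i j hij (π (ι x)) = 0 at this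
  rwa [hπx] at this

theorem proposition3p10 {R M : Type*} [Ring R] [AddCommGroup M] [Module Rᵐᵒᵖ M]
    (hM : IsFProjective R M)
    -- the endomorphism ring `S` is right noetherian, i.e. noetherian as a right `S`-module
    (hS : IsNoetherian (Module.End Rᵐᵒᵖ M)ᵐᵒᵖ (Module.End Rᵐᵒᵖ M))
    (hflat : IsFlatLeftModule (Module.End Rᵐᵒᵖ M) M)
    -- a direct system `(G i, f i j)` in `add M`, indexed by a directed set `I`
    {I : Type*} [Preorder I] [IsDirectedOrder I] [Nonempty I] [DecidableEq I]
    (G : I → Type*) [∀ i, AddCommGroup (G i)] [∀ i, Module Rᵐᵒᵖ (G i)]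
    (f : ∀ i j, i ≤ j → G i →ₗ[Rᵐᵒᵖ] G j) [DirectedSystem G fun i j h => f i j h]
    (hG : ∀ i, MemAdd R M (G i))
    -- its direct limit `N`
    {N : Type*} [AddCommGroup N] [Module Rᵐᵒᵖ N]
    (e : Module.DirectLimit G f ≃ₗ[Rᵐᵒᵖ] N) :
    IsFProjective R N := by
  let u : ∀ i, G i →ₗ[Rᵐᵒᵖ] N := fun i => e.toLinearMap ∘ₗ Module.DirectLimit.of Rᵐᵒᵖ I G f i
  have hu : ∀ i j (hij : i ≤ j) x, u j (f i j hij x) = u i x := fun i j hij x =>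
    congrArg e Module.DirectLimit.of_f
  intro C hC
  obtain ⟨i, D, hD, rfl⟩ : ∃ (i : I) (D : Submodule Rᵐᵒᵖ (G i)), D.FG ∧ D.map (u i) = C := by
    induction C, hC using Submodule.fg_induction with
    | singleton x =>
      obtain ⟨i, y, hy⟩ := Module.DirectLimit.exists_of (e.symm x)
      refine ⟨i, Submodule.span _ {y}, Submodule.fg_span_singleton y, ?_⟩
      rw [Submodule.map_span, Set.image_singleton]
      simp [u, hy]
    | sup C₁ C₂ _ _ h₁ h₂ =>
      obtain ⟨i₁, D₁, hD₁, rfl⟩ := h₁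
      obtain ⟨i₂, D₂, hD₂, rfl⟩ := h₂
      obtain ⟨i, hi₁, hi₂⟩ := exists_ge_ge i₁ i₂
      have hmap : ∀ l (hl : l ≤ i) (D : Submodule Rᵐᵒᵖ (G l)),
          (D.map (f l i hl)).map (u i) = D.map (u l) := fun l hl D => by
        rw [← Submodule.map_comp]
        congr 1
        ext x
        exact hu l i hl x
      refine ⟨i, D₁.map (f i₁ i hi₁) ⊔ D₂.map (f i₂ i hi₂), (hD₁.map _).sup (hD₂.map _), ?_⟩
      rw [Submodule.map_sup, hmap, hmap]
  obtain ⟨j, hij, hj⟩ := exists_ker_le_ker_of_memAdd hS hflat G f hG i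
  obtain ⟨n, g, h, hgh⟩ := hM.of_memAdd (hG j) (D.map (f i j hij)) (hD.map _)
  let v : D.map (f i j hij) →ₗ[Rᵐᵒᵖ] D.map (u i) := (u j).restrict (by
    rintro _ ⟨x, hx, rfl⟩
    exact ⟨x, hx, (hu i j hij x).symm⟩)
  have hv : Function.Bijective v := by
    constructor
    · rw [← LinearMap.ker_eq_bot, LinearMap.ker_eq_bot']
      rintro ⟨_, x, hx, rfl⟩ h0
      have h1 : u j (f i j hij x) = 0 := congrArg Subtype.val h0
      -- An element vanishing in the limit already vanishes in some `G k` with `k ≥ j`, hence in `G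
      -- j` by the choice of `j`.
      obtain ⟨k, hjk, hk⟩ := Module.DirectLimit.of.zero_exact (e.map_eq_zero_iff.1 h1)
      rw [DirectedSystem.map_map' (f := f)] at hk
      exact Subtype.ext (hj k (hij.trans hjk) hjk hk)
    · rintro ⟨_, x, hx, rfl⟩
      exact ⟨⟨_, x, hx, rfl⟩, Subtype.ext (hu i j hij x)⟩
  let w := LinearEquiv.ofBijective v hv
  refine ⟨n, g ∘ₗ w.symm.toLinearMap, u j ∘ₗ h, ?_⟩
  ext c
  obtain ⟨d, rfl⟩ := w.surjective c
  have hd : h (g d) = d := LinearMap.congr_fun hgh d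
  simp only [LinearMap.comp_apply, LinearEquiv.coe_coe, LinearEquiv.symm_apply_apply, hd]
  rfl
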